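/- Let $F$ be an arbitrary field of characteristic $0$. Put $f(x,y)=x^2+y^4-1\in F[x,y]$ and $\Gamma=F[x,y]/fF[x,y]$, and denote the images of $x,y$ in $\Gamma$ again by $x,y$. Let $D$ be the derivation of $\Gamma$ induced by $2y^3\frac{\partial}{\partial x}-x\frac{\partial}{\partial y}$, let $A$ be the subalgebra of $\Gamma$ generated by $1,y^2,xy$, and put $M=xA+yA\subseteq\Gamma$. The Cheng–Kac superalgebra $CK(\Gamma,D)=J_0\oplus J_1$ is the $\mathbb Z_2$-graded $F$-algebra with $J_0=\Gamma\oplus w_1\Gamma\oplus w_2\Gamma\oplus w_3\Gamma$ and $J_1=\overline\Gamma\oplus x_1\overline\Gamma\oplus x_2\overline\Gamma\oplus x_3\overline\Gamma$ (each summand being a copy of $\Gamma$), with multiplication given for $a,b\in\Gamma$ and $i,j\in\{1,2,3\}$ by $$a\cdot b=ab,\quad a\cdot w_ib=w_ib\cdot a=w_i(ab),\quad w_1a\cdot w_1b=w_2a\cdot w_2b=ab,\quad w_3a\cdot w_3b=-ab,\quad w_ia\cdot w_jb=0\ (i\ne j);$$ $$a\cdot\overline b=\overline{ab},\quad a\cdot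 x_i\overline b=x_i\overline{ab},\quad w_ia\cdot\overline b=x_i\overline{D(a)b},\quad w_ia\cdot x_j\overline b=x_{i\times j}\overline{ab};$$ $$\overline a\cdot\overline b=D(a)b-aD(b),\quad \overline a\cdot x_i\overline b=-w_i(ab),\quad x_i\overline a\cdot\overline b=w_i(ab),\quad x_i\overline a\cdot x_j\overline b=0,$$ where $x_{i\times i}=0$, $x_{1\times2}=-x_{2\times1}=x_3$, $x_{1\times3}=-x_{3\times1}=x_2$, $x_{2\times3}=-x_{3\times2}=-x_1$, and $v\cdot u=u\cdot v$ for $u\in J_0$, $v\in J_1$. Theorem 2. The subspace $$GCK(A,\Delta)=A+w_1A+w_2A+w_3A+\overline M+x_1\overline M+x_2\overline M+x_3\overline M$$ of $CK(\Gamma,D)$ is closed under multiplication and, with even part $A+w_1A+w_2A+w_3A$ and odd part $\overline M+x_1\overline M+x_2\overline M+x_3\overline M$, it is a simple unital Jordan superalgebra. (Simple means that the product is not identically zero and that the only $\mathbb Z_2$-graded two-sided ideals are $0$ and the whole superalgebra. A superalgebra is Jordan if, writing $R_u$ for right multiplication by $u$, operators acting on the right, and $p(u)$ for the parity of a homogeneous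 element $u$, all homogeneous $a,b,c$ satisfy $$aR_b=(-1)^{p(a)p(b)}bR_a,\qquad R_{a^2}R_a=R_aR_{a^2},$$ $$R_aR_bR_c+(-1)^{p(a)p(b)+p(a)p(c)+p(b)p(c)}R_cR_bR_a+(-1)^{p(b)p(c)}R_{(ac)b}=R_aR_{bc}+(-1)^{p(a)p(b)}R_bR_{ac}+(-1)^{p(a)p(c)+p(b)p(c)}R_cR_{ab}.)$$ -/

import Mathlib

/-! ### Superalgebras, Jordan superalgebras, simplicity -/

/-- The sign `(-1)^p` of a parity `p : ZMod 2`. -/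
def paritySign (p : ZMod 2) : ℤ := if p = 0 then 1 else -1

section Superalgebras

variable (F : Type*) [Field F] {J : Type*} [NonUnitalNonAssocRing J] [Module F J]
  [IsScalarTower F J J] [SMulCommClass F J J]

/-- `J = 𝒥 0 ⊕ 𝒥 1` is a (not necessarily associative or unital) superalgebra, i.e. a
`ZMod 2`-graded algebra, over `F`. -/
structure IsSuperalgebra (𝒥 : ZMod 2 → Submodule F J) : Prop where
  isInternal : DirectSum.IsInternal 𝒥
  mul_mem : ∀ {p q : ZMod 2} {a b : J}, a ∈ 𝒥 p → b ∈ 𝒥 q → a * b ∈ 𝒥 (p + q)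

/-- A Jordan superalgebra. With `R_a` the right multiplication `u ↦ u * a` and operators written
on the right of their argument (so `u (R_a R_b) = (u * a) * b`), homogeneous `a`, `b`, `c` satisfy
* `a R_b = (-1)^{p(a)p(b)} b R_a`;
* `R_{a²} R_a = R_a R_{a²}`;
* `R_a R_b R_c + (-1)^{p(a)p(b)+p(a)p(c)+p(b)p(c)} R_c R_b R_a + (-1)^{p(b)p(c)} R_{(ac)b}
    = R_a R_{bc} + (-1)^{p(a)p(b)} R_b R_{ac} + (-1)^{p(a)p(c)+p(b)p(c)} R_c R_{ab}`. -/
structure IsJordanSuperalgebra (𝒥 : ZMod 2 → Submodule F J) : Prop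
    extends IsSuperalgebra F 𝒥 where
  supercomm : ∀ {p q : ZMod 2} {a b : J}, a ∈ 𝒥 p → b ∈ 𝒥 q →
    a * b = paritySign (p * q) • (b * a)
  jordan : ∀ {p : ZMod 2} {a : J}, a ∈ 𝒥 p → ∀ u : J,
    (u * (a * a)) * a = (u * a) * (a * a)
  jordan_linearized : ∀ {p q r : ZMod 2} {a b c : J}, a ∈ 𝒥 p → b ∈ 𝒥 q → c ∈ 𝒥 r → ∀ u : J,
    ((u * a) * b) * c + paritySign (p * q + p * r + q * r) • (((u * c) * b) * a)
        + paritySign (q * r) • (u * ((a * c) * b))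
      = (u * a) * (b * c) + paritySign (p * q) • ((u * b) * (a * c))
        + paritySign (p * r + q * r) • ((u * c) * (a * b))

/-- `I` is a two-sided ideal which is graded: `I = (I ∩ 𝒥 0) + (I ∩ 𝒥 1)`. -/
structure IsGradedIdeal (𝒥 : ZMod 2 → Submodule F J) (I : Submodule F J) : Prop where
  mul_mem_left : ∀ (u : J) {v : J}, v ∈ I → u * v ∈ I
  mul_mem_right : ∀ (u : J) {v : J}, v ∈ I → v * u ∈ I
  graded : I = (I ⊓ 𝒥 0) ⊔ (I ⊓ 𝒥 1)

/-- A superalgebra is simple if its multiplication is nonzero and it has no graded ideals other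
than `0` and itself. -/
structure IsSimpleSuperalgebra (𝒥 : ZMod 2 → Submodule F J) : Prop where
  mul_ne_zero : ∃ u v : J, u * v ≠ 0
  eq_bot_or_eq_top : ∀ I : Submodule F J, IsGradedIdeal F 𝒥 I → I = ⊥ ∨ I = ⊤

end Superalgebras

/-- The algebra `J` has a two-sided unit. -/
def HasUnit (J : Type*) [Mul J] : Prop := ∃ e : J, ∀ u : J, e * u = u ∧ u * e = u

/-- The grading induced on a subalgebra by a grading of the ambient algebra: the homogeneous
components are the intersections with those of the ambient algebra. -/
def inducedGrading {F J : Type*} [Field F] [NonUnitalNonAssocRing J] [Module F J]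
    (𝒥 : ZMod 2 → Submodule F J) (S : NonUnitalSubalgebra F J) : ZMod 2 → Submodule F S :=
  fun p => (𝒥 p).comap (NonUnitalSubalgebraClass.subtype S : S →ₗ[F] J)

/-! ### The Cheng–Kac superalgebra -/

section ChengKac

variable {F Γ : Type*} [Field F] [CommRing Γ] [Algebra F Γ]

/-- The underlying space of the Cheng–Kac superalgebra `CK(Γ, D)`. The element
`⟨a, w, m, x⟩` stands for
`a + w₁ w(0) + w₂ w(1) + w₃ w(2) + m̄ + x₁ \bar{x(0)} + x₂ \bar{x(1)} + x₃ \bar{x(2)}`. -/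
@[ext]
structure CK (D : Derivation F Γ Γ) where
  /-- the component in `Γ` -/
  a : Γ
  /-- the components in `w₁ Γ`, `w₂ Γ`, `w₃ Γ` -/
  w : Fin 3 → Γ
  /-- the component in `Γ̄` -/
  m : Γ
  /-- the components in `x₁ Γ̄`, `x₂ Γ̄`, `x₃ Γ̄` -/
  x : Fin 3 → Γ

namespace CK

variable {D : Derivation F Γ Γ}

instance : Zero (CK D) := ⟨⟨0, 0, 0, 0⟩⟩
instance : Add (CK D) := ⟨fun u v => ⟨u.a + v.a, u.w + v.w, u.m + v.m, u.x + v.x⟩⟩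
instance : Neg (CK D) := ⟨fun u => ⟨-u.a, -u.w, -u.m, -u.x⟩⟩
instance : SMul F (CK D) := ⟨fun c u => ⟨c • u.a, c • u.w, c • u.m, c • u.x⟩⟩

/-- The bilinear operation `(∑ wᵢ fᵢ, ∑ xⱼ ḡⱼ) ↦ ∑ x_{i×j} \bar{fᵢ gⱼ}` in the coordinates with
respect to `x₁, x₂, x₃`, where `x_{i×i} = 0`, `x_{1×2} = -x_{2×1} = x₃`,
`x_{1×3} = -x_{3×1} = x₂`, `x_{2×3} = -x_{3×2} = -x₁`. -/
def cross (f g : Fin 3 → Γ) : Fin 3 → Γ :=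
  ![f 2 * g 1 - f 1 * g 2, f 0 * g 2 - f 2 * g 0, f 0 * g 1 - f 1 * g 0]

/-- The product of two even elements:
`a · b = ab`, `a · wᵢ b = wᵢ b · a = wᵢ ab`, `w₁ a · w₁ b = w₂ a · w₂ b = ab`, `w₃ a · w₃ b = -ab`,
`wᵢ a · wⱼ b = 0` for `i ≠ j`. It takes and returns the `a` and `w` components. -/
def mulEvenEven (a : Γ) (w : Fin 3 → Γ) (b : Γ) (z : Fin 3 → Γ) : Γ × (Fin 3 → Γ) :=
  (a * b + (w 0 * z 0 + w 1 * z 1 - w 2 * z 2), fun i => a * z i + b * w i)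

/-- The product of an even element (components `a`, `w`) and an odd element (components `n`, `y`),
in either order:
`a · b̄ = \bar{ab}`, `a · xᵢ b̄ = xᵢ \bar{ab}`, `wᵢ a · b̄ = xᵢ \bar{D(a)b}`,
`wᵢ a · xⱼ b̄ = x_{i×j} \bar{ab}`. It returns the `m` and `x` components. -/
def mulEvenOdd (D : Derivation F Γ Γ) (a : Γ) (w : Fin 3 → Γ) (n : Γ) (y : Fin 3 → Γ) :
    Γ × (Fin 3 → Γ) :=
  (a * n, fun i => a * y i + D (w i) * n + cross w y i)

/-- The product of two odd elements:
`ā · b̄ = D(a)b - aD(b)`, `ā · xᵢ b̄ = -wᵢ(ab)`, `xᵢ ā · b̄ = wᵢ(ab)`, `xᵢ ā · xⱼ b̄ = 0`.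
It returns the `a` and `w` components. -/
def mulOddOdd (D : Derivation F Γ Γ) (m : Γ) (x : Fin 3 → Γ) (n : Γ) (y : Fin 3 → Γ) :
    Γ × (Fin 3 → Γ) :=
  (D m * n - m * D n, fun i => x i * n - m * y i)

/-- `(a₀ + a₁) · (b₀ + b₁) = (a₀ · b₀ + a₁ · b₁) + (a₀ · b₁ + a₁ · b₀)`, where the product of an
odd and an even element is the product in the other order. -/
instance : Mul (CK D) := ⟨fun u v =>
  ⟨(mulEvenEven u.a u.w v.a v.w).1 + (mulOddOdd D u.m u.x v.m v.x).1,
   (mulEvenEven u.a u.w v.a v.w).2 + (mulOddOdd D u.m u.x v.m v.x).2,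
   (mulEvenOdd D u.a u.w v.m v.x).1 + (mulEvenOdd D v.a v.w u.m u.x).1,
   (mulEvenOdd D u.a u.w v.m v.x).2 + (mulEvenOdd D v.a v.w u.m u.x).2⟩⟩

@[simp] theorem zero_a : (0 : CK D).a = 0 := rfl
@[simp] theorem zero_w : (0 : CK D).w = 0 := rfl
@[simp] theorem zero_m : (0 : CK D).m = 0 := rfl
@[simp] theorem zero_x : (0 : CK D).x = 0 := rfl
@[simp] theorem add_a (u v : CK D) : (u + v).a = u.a + v.a := rfl
@[simp] theorem add_w (u v : CK D) : (u + v).w = u.w + v.w := rfl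
@[simp] theorem add_m (u v : CK D) : (u + v).m = u.m + v.m := rfl
@[simp] theorem add_x (u v : CK D) : (u + v).x = u.x + v.x := rfl
@[simp] theorem neg_a (u : CK D) : (-u).a = -u.a := rfl
@[simp] theorem neg_w (u : CK D) : (-u).w = -u.w := rfl
@[simp] theorem neg_m (u : CK D) : (-u).m = -u.m := rfl
@[simp] theorem neg_x (u : CK D) : (-u).x = -u.x := rfl
@[simp] theorem smul_a (c : F) (u : CK D) : (c • u).a = c • u.a := rfl
@[simp] theorem smul_w (c : F) (u : CK D) : (c • u).w = c • u.w := rfl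
@[simp] theorem smul_m (c : F) (u : CK D) : (c • u).m = c • u.m := rfl
@[simp] theorem smul_x (c : F) (u : CK D) : (c • u).x = c • u.x := rfl

theorem mul_a (u v : CK D) : (u * v).a =
    u.a * v.a + (u.w 0 * v.w 0 + u.w 1 * v.w 1 - u.w 2 * v.w 2)
      + (D u.m * v.m - u.m * D v.m) := rfl
theorem mul_w (u v : CK D) (i : Fin 3) : (u * v).w i =
    u.a * v.w i + v.a * u.w i + (u.x i * v.m - u.m * v.x i) := rfl
theorem mul_m (u v : CK D) : (u * v).m = u.a * v.m + v.a * u.m := rfl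
theorem mul_x (u v : CK D) (i : Fin 3) : (u * v).x i =
    (u.a * v.x i + D (u.w i) * v.m + cross u.w v.x i)
      + (v.a * u.x i + D (v.w i) * u.m + cross v.w u.x i) := rfl

instance : AddCommGroup (CK D) where
  add_assoc u v t := by ext <;> simp [add_assoc]
  zero_add u := by ext <;> simp
  add_zero u := by ext <;> simp
  nsmul := nsmulRec
  zsmul := zsmulRec
  neg_add_cancel u := by ext <;> simp
  add_comm u v := by ext <;> simp [add_comm]

instance : Module F (CK D) where
  one_smul u := by ext <;> simp
  mul_smul c d u := by ext <;> simp [mul_smul]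
  smul_zero c := by ext <;> simp
  smul_add c u v := by ext <;> simp
  add_smul c d u := by ext <;> simp [add_smul]
  zero_smul u := by ext <;> simp

instance : NonUnitalNonAssocRing (CK D) where
  left_distrib u v t := by
    ext i
    · simp only [mul_a, add_a, add_w, add_m, Pi.add_apply, map_add]; ring
    · simp only [mul_w, add_a, add_w, add_m, add_x, Pi.add_apply]; ring
    · simp only [mul_m, add_a, add_m]; ring
    · fin_cases i <;>
        simp [mul_x, cross] <;> ring
  right_distrib u v t := by
    ext i
    · simp only [mul_a, add_a, add_w, add_m, Pi.add_apply, map_add]; ring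
    · simp only [mul_w, add_a, add_w, add_m, add_x, Pi.add_apply]; ring
    · simp only [mul_m, add_a, add_m]; ring
    · fin_cases i <;>
        simp [mul_x, cross] <;> ring
  zero_mul u := by
    ext i
    · simp [mul_a]
    · simp [mul_w]
    · simp [mul_m]
    · fin_cases i <;> simp [mul_x, cross]
  mul_zero u := by
    ext i
    · simp [mul_a]
    · simp [mul_w]
    · simp [mul_m]
    · fin_cases i <;> simp [mul_x, cross]

instance : IsScalarTower F (CK D) (CK D) where
  smul_assoc c u v := by
    ext i
    · simp [mul_a, smul_add, smul_sub]
    · simp [mul_w, smul_add, smul_sub]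
    · simp [mul_m]
    · fin_cases i <;> simp [mul_x, cross, smul_add, smul_sub]

instance : SMulCommClass F (CK D) (CK D) where
  smul_comm c u v := by
    ext i
    · simp [mul_a, smul_add, smul_sub]
    · simp [mul_w, smul_add, smul_sub]
    · simp [mul_m]
    · fin_cases i <;> simp [mul_x, cross, smul_add, smul_sub]

variable (D) in
/-- The even part `J₀ = Γ + w₁Γ + w₂Γ + w₃Γ`. -/
def evenPart : Submodule F (CK D) where
  carrier := {u | u.m = 0 ∧ u.x = 0}
  add_mem' := fun hu hv => ⟨by simp [hu.1, hv.1], by simp [hu.2, hv.2]⟩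
  zero_mem' := ⟨rfl, rfl⟩
  smul_mem' := fun c u hu => ⟨by simp [hu.1], by simp [hu.2]⟩

variable (D) in
/-- The odd part `J₁ = Γ̄ + x₁Γ̄ + x₂Γ̄ + x₃Γ̄`. -/
def oddPart : Submodule F (CK D) where
  carrier := {u | u.a = 0 ∧ u.w = 0}
  add_mem' := fun hu hv => ⟨by simp [hu.1, hv.1], by simp [hu.2, hv.2]⟩
  zero_mem' := ⟨rfl, rfl⟩
  smul_mem' := fun c u hu => ⟨by simp [hu.1], by simp [hu.2]⟩

variable (D) in
/-- The `ZMod 2`-grading of `CK(Γ, D)`. -/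
def grading : ZMod 2 → Submodule F (CK D) := fun p => if p = 0 then evenPart D else oddPart D

variable (D) in
/-- For `F`-subspaces `A` and `M` of `Γ`, the subspace
`A + w₁A + w₂A + w₃A + M̄ + x₁M̄ + x₂M̄ + x₃M̄` of `CK(Γ, D)`. -/
def subspaceOf (A M : Submodule F Γ) : Submodule F (CK D) where
  carrier := {u | u.a ∈ A ∧ (∀ i, u.w i ∈ A) ∧ u.m ∈ M ∧ ∀ i, u.x i ∈ M}
  add_mem' := fun hu hv => ⟨A.add_mem hu.1 hv.1, fun i => A.add_mem (hu.2.1 i) (hv.2.1 i),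
    M.add_mem hu.2.2.1 hv.2.2.1, fun i => M.add_mem (hu.2.2.2 i) (hv.2.2.2 i)⟩
  zero_mem' := ⟨A.zero_mem, fun _ => A.zero_mem, M.zero_mem, fun _ => M.zero_mem⟩
  smul_mem' := fun c _ hu => ⟨A.smul_mem c hu.1, fun i => A.smul_mem c (hu.2.1 i),
    M.smul_mem c hu.2.2.1, fun i => M.smul_mem c (hu.2.2.2 i)⟩

end CK

end ChengKac

/-! ### The curve `x² + y⁴ = 1` and the superalgebra `GCK(A, Δ)` -/

namespace Curve

variable (F : Type*) [Field F]

/-- The polynomial `f(x, y) = x² + y⁴ - 1` in `F[x, y]`, with `x = X 0` and `y = X 1`. -/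
noncomputable def f : MvPolynomial (Fin 2) F :=
  MvPolynomial.X 0 ^ 2 + MvPolynomial.X 1 ^ 4 - 1

/-- The derivation `D = 2y³ ∂/∂x - x ∂/∂y` of `F[x, y]`. -/
noncomputable def polyD : Derivation F (MvPolynomial (Fin 2) F) (MvPolynomial (Fin 2) F) :=
  (2 * MvPolynomial.X 1 ^ 3 : MvPolynomial (Fin 2) F) • MvPolynomial.pderiv 0
    - (MvPolynomial.X 0 : MvPolynomial (Fin 2) F) • MvPolynomial.pderiv 1

/-- The algebra `Γ = F[x, y] / f F[x, y]`. -/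
abbrev Γ : Type _ := MvPolynomial (Fin 2) F ⧸ Ideal.span {f F}

/-- The image of `x` in `Γ`. -/
noncomputable def x : Γ F := Ideal.Quotient.mk (Ideal.span {f F}) (MvPolynomial.X 0)

/-- The image of `y` in `Γ`. -/
noncomputable def y : Γ F := Ideal.Quotient.mk (Ideal.span {f F}) (MvPolynomial.X 1)

theorem polyD_f : polyD F (f F) = 0 := by
  simp [polyD, f, Derivation.leibniz_pow, MvPolynomial.pderiv_X]
  ring

theorem mk_polyD (p : MvPolynomial (Fin 2) F)
    (hp : Ideal.Quotient.mkₐ F (Ideal.span {f F}) p = 0) :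
    Ideal.Quotient.mkₐ F (Ideal.span {f F}) (polyD F p) = 0 := by
  rw [Ideal.Quotient.mkₐ_eq_mk, Ideal.Quotient.eq_zero_iff_mem, Ideal.mem_span_singleton] at hp ⊢
  obtain ⟨q, rfl⟩ := hp
  rw [Derivation.leibniz, polyD_f, smul_zero, add_zero, smul_eq_mul]
  exact dvd_mul_right _ _

/-- The derivation of `Γ` induced by `D = 2y³ ∂/∂x - x ∂/∂y`. -/
noncomputable def D : Derivation F (Γ F) (Γ F) :=
  Derivation.liftOfSurjective (Ideal.Quotient.mkₐ_surjective F (Ideal.span {f F})) (mk_polyD F)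

/-- `D` is the map induced on the quotient. -/
theorem D_mk (p : MvPolynomial (Fin 2) F) :
    D F (Ideal.Quotient.mk (Ideal.span {f F}) p)
      = Ideal.Quotient.mk (Ideal.span {f F}) (polyD F p) :=
  Derivation.liftOfSurjective_apply
    (Ideal.Quotient.mkₐ_surjective F (Ideal.span {f F})) (mk_polyD F) p

/-- The subalgebra `A` of `Γ` generated by `1`, `y²` and `xy`. -/
noncomputable def A : Subalgebra F (Γ F) := Algebra.adjoin F {1, y F ^ 2, x F * y F}

/-- The `A`-submodule `M = xA + yA` of `Γ`. -/
noncomputable def M : Submodule (A F) (Γ F) := Submodule.span (A F) {x F, y F}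

/-- The subspace `GCK(A, Δ) = A + w₁A + w₂A + w₃A + M̄ + x₁M̄ + x₂M̄ + x₃M̄` of `CK(Γ, D)`. -/
noncomputable def GCK : Submodule F (CK (D F)) :=
  CK.subspaceOf (D F) (Subalgebra.toSubmodule (A F)) ((M F).restrictScalars F)

end Curve

/-! The Jordan identities hold in `CK(Γ, D)` for every commutative `Γ` with derivation `D`, in
characteristic 0. They are checked coordinate by coordinate, using only the Leibniz rule and
commutativity, and they pass to the subspace. Closure under multiplication comes from `M · M ⊆ A`,
`D(A) ⊆ A` and `D(M) ⊆ M`.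

For simplicity put `t = y²`, `s = xy`. Then `s² = t - t³`, `D t = -2s`, `D s = 3t² - 1`. Let `J` be
a graded ideal and `K` the set of those `a` in `Γ` whose copy in the even part lies in `J`.
Multiplying by suitable even and odd elements moves every coordinate of `J`, up to factors from `M`
or `D(A)`, into `K` (`ofΓ_mem_of_even`, `ofΓ_mem_of_odd`, `ofΓ_D_mem_of_odd`). Moreover `K` is
`D`-stable (`ofΓ_D_mem`).

If `K ≠ 0`, then `1 ∈ K`, because `A` is differentially simple (`one_mem_of_D_stable`). If `K = 0`,
all coordinates vanish: `x, y ∈ M` generate the unit ideal of `Γ`, since `x·x + y³·y = 1`, and so do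
`D t, D s`, by the identity `(3t² - 2)(3t² - 1) + 9ts² = 2`. The same identity drives the last step
of differential simplicity. -/

namespace CK

/-! ### Grading and Jordan identities of `CK(Γ, D)`. -/

section Jordan

variable {F Γ : Type*} [Field F] [CommRing Γ] [Algebra F Γ] {D : Derivation F Γ Γ}

theorem mul_x_zero (u v : CK D) : (u * v).x 0 =
    (u.a * v.x 0 + D (u.w 0) * v.m + (u.w 2 * v.x 1 - u.w 1 * v.x 2))
      + (v.a * u.x 0 + D (v.w 0) * u.m + (v.w 2 * u.x 1 - v.w 1 * u.x 2)) := rfl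
theorem mul_x_one (u v : CK D) : (u * v).x 1 =
    (u.a * v.x 1 + D (u.w 1) * v.m + (u.w 0 * v.x 2 - u.w 2 * v.x 0))
      + (v.a * u.x 1 + D (v.w 1) * u.m + (v.w 0 * u.x 2 - v.w 2 * u.x 0)) := rfl
theorem mul_x_two (u v : CK D) : (u * v).x 2 =
    (u.a * v.x 2 + D (u.w 2) * v.m + (u.w 0 * v.x 1 - u.w 1 * v.x 0))
      + (v.a * u.x 2 + D (v.w 2) * u.m + (v.w 0 * u.x 1 - v.w 1 * u.x 0)) := rfl

theorem ext_coords {u v : CK D} (ha : u.a = v.a) (hw0 : u.w 0 = v.w 0) (hw1 : u.w 1 = v.w 1)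
    (hw2 : u.w 2 = v.w 2) (hm : u.m = v.m) (hx0 : u.x 0 = v.x 0) (hx1 : u.x 1 = v.x 1)
    (hx2 : u.x 2 = v.x 2) : u = v := by
  ext i
  · exact ha
  · fin_cases i <;> assumption
  · exact hm
  · fin_cases i <;> assumption

theorem mem_grading_zero {u : CK D} : u ∈ grading D 0 ↔ u.m = 0 ∧ u.x = 0 := Iff.rfl

theorem mem_grading_one {u : CK D} : u ∈ grading D 1 ↔ u.a = 0 ∧ u.w = 0 := Iff.rfl

theorem isCompl_grading : IsCompl (grading D 0) (grading D 1) := by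
  rw [isCompl_iff, Submodule.disjoint_def, codisjoint_iff, eq_top_iff]
  refine ⟨fun u h0 h1 => ?_, fun u _ => ?_⟩
  · rw [mem_grading_zero] at h0
    rw [mem_grading_one] at h1
    exact CK.ext h1.1 h1.2 h0.1 h0.2
  · refine Submodule.mem_sup.2 ⟨⟨u.a, u.w, 0, 0⟩, ⟨rfl, rfl⟩, ⟨0, 0, u.m, u.x⟩, ⟨rfl, rfl⟩, ?_⟩
    ext <;> simp

theorem forall_zmod_two {P : ZMod 2 → Prop} (h0 : P 0) (h1 : P 1) (p : ZMod 2) : P p := by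
  fin_cases p
  · exact h0
  · exact h1

theorem mul_mem_grading : ∀ p q : ZMod 2, ∀ {u v : CK D}, u ∈ grading D p → v ∈ grading D q →
    u * v ∈ grading D (p + q) := by
  refine forall_zmod_two (forall_zmod_two ?_ ?_) (forall_zmod_two ?_ ?_) <;> intro u v hu hv
  · rw [mem_grading_zero] at hu hv
    refine mem_grading_zero.2 ⟨by simp [mul_m, hu, hv], ?_⟩
    ext i; fin_cases i <;> simp [mul_x_zero, mul_x_one, mul_x_two, hu, hv]
  · rw [mem_grading_zero] at hu
    rw [mem_grading_one] at hv
    refine mem_grading_one.2 ⟨by simp [mul_a, hu, hv], ?_⟩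
    ext i; simp [mul_w, hu, hv]
  · rw [mem_grading_one] at hu
    rw [mem_grading_zero] at hv
    refine mem_grading_one.2 ⟨by simp [mul_a, hu, hv], ?_⟩
    ext i; simp [mul_w, hu, hv]
  · rw [mem_grading_one] at hu hv
    refine mem_grading_zero.2 ⟨by simp [mul_m, hu, hv], ?_⟩
    ext i; fin_cases i <;> simp [mul_x_zero, mul_x_one, mul_x_two, hu, hv]

theorem supercomm : ∀ p q : ZMod 2, ∀ {u v : CK D}, u ∈ grading D p → v ∈ grading D q →
    u * v = paritySign (p * q) • (v * u) := by
  refine forall_zmod_two (forall_zmod_two ?_ ?_) (forall_zmod_two ?_ ?_) <;>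
    rintro ⟨a, w, m, x⟩ ⟨b, z, n, y⟩ ⟨hu, hu'⟩ ⟨hv, hv'⟩ <;> dsimp only at hu hu' hv hv' <;>
    subst hu hu' hv hv' <;> simp [paritySign] <;>
    apply ext_coords <;> simp [mul_a, mul_w, mul_m, mul_x_zero, mul_x_one, mul_x_two] <;> ring

theorem jordan_even {v : CK D} (hv : v ∈ grading D 0) (u : CK D) :
    (u * (v * v)) * v = (u * v) * (v * v) := by
  obtain ⟨b, z, n, y⟩ := v
  obtain ⟨hv, hv'⟩ := hv
  dsimp only at hv hv'
  subst hv hv'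
  apply ext_coords <;> simp [mul_a, mul_w, mul_m, mul_x_zero, mul_x_one, mul_x_two] <;> ring

-- In each of the eight parity cases, expanding by the Leibniz rule leaves, in every coordinate, a
-- polynomial identity in the components and their iterated derivatives.
set_option maxHeartbeats 4000000 in
theorem jordan_linearized : ∀ p q r : ZMod 2, ∀ {a b c : CK D}, a ∈ grading D p →
    b ∈ grading D q → c ∈ grading D r → ∀ u : CK D,
    ((u * a) * b) * c + paritySign (p * q + p * r + q * r) • (((u * c) * b) * a)
        + paritySign (q * r) • (u * ((a * c) * b))
      = (u * a) * (b * c) + paritySign (p * q) • ((u * b) * (a * c))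
        + paritySign (p * r + q * r) • ((u * c) * (a * b)) := by
  refine forall_zmod_two
    (forall_zmod_two (forall_zmod_two ?_ ?_) (forall_zmod_two ?_ ?_))
    (forall_zmod_two (forall_zmod_two ?_ ?_) (forall_zmod_two ?_ ?_)) <;>
    rintro ⟨a, w, m, x⟩ ⟨b, z, n, y⟩ ⟨c, s, k, t⟩ ⟨ha, ha'⟩ ⟨hb, hb'⟩ ⟨hc, hc'⟩ u <;>
    dsimp only at ha ha' hb hb' hc hc' <;>
    subst ha ha' hb hb' hc hc' <;>
    simp only [paritySign, mul_zero, add_zero, zero_add, mul_one, if_true, one_smul,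
      show (1 : ZMod 2) ≠ 0 by decide, if_false, neg_smul, show (1 + 1 : ZMod 2) = 0 from rfl] <;>
    apply ext_coords <;> simp [mul_a, mul_w, mul_m, mul_x_zero, mul_x_one, mul_x_two] <;> ring

end Jordan

end CK
theorem isInternal_of_isCompl {F J : Type*} [Field F] [AddCommGroup J] [Module F J]
    {𝒥 : ZMod 2 → Submodule F J} (h : IsCompl (𝒥 0) (𝒥 1)) : DirectSum.IsInternal 𝒥 :=
  (DirectSum.isInternal_submodule_iff_isCompl 𝒥 zero_ne_one
    (Set.eq_univ_of_forall (CK.forall_zmod_two (by simp) (by simp))).symm).2 h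

namespace CK

section Jordan

variable {F Γ : Type*} [Field F] [CommRing Γ] [Algebra F Γ] {D : Derivation F Γ Γ}

theorem isJordanSuperalgebra [CharZero F] : IsJordanSuperalgebra F (grading D) where
  isInternal := isInternal_of_isCompl isCompl_grading
  mul_mem ha hb := mul_mem_grading _ _ ha hb
  supercomm ha hb := supercomm _ _ ha hb
  jordan {p} {a} ha u := by
    refine forall_zmod_two (P := fun p => a ∈ grading D p → u * (a * a) * a = u * a * (a * a))
      (fun ha => jordan_even ha u) (fun ha => ?_) p ha
    -- Odd elements anticommute, so an odd element squares to 0 and both sides vanish.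
    have h1 : a * a = -(a * a) := by simpa [paritySign] using supercomm 1 1 ha ha
    have h2 : (2 : F) • (a * a) = 0 := by
      rw [two_smul]
      nth_rewrite 1 [h1]
      exact neg_add_cancel _
    rw [(smul_eq_zero.1 h2).resolve_left two_ne_zero, mul_zero, zero_mul, mul_zero]
  jordan_linearized ha hb hc u := jordan_linearized _ _ _ ha hb hc u

end Jordan

end CK

theorem IsJordanSuperalgebra.induced {F J : Type*} [Field F] [NonUnitalNonAssocRing J]
    [Module F J] [IsScalarTower F J J] [SMulCommClass F J J] {𝒥 : ZMod 2 → Submodule F J}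
    (h : IsJordanSuperalgebra F 𝒥) (S : NonUnitalSubalgebra F J)
    (hS : DirectSum.IsInternal (inducedGrading 𝒥 S)) :
    IsJordanSuperalgebra F (inducedGrading 𝒥 S) where
  isInternal := hS
  mul_mem ha hb := h.mul_mem ha hb
  supercomm ha hb := Subtype.ext (h.supercomm ha hb)
  jordan ha _ := Subtype.ext (h.jordan ha _)
  jordan_linearized ha hb hc _ := Subtype.ext (h.jordan_linearized ha hb hc _)
namespace Curve

/-! ### Relations in `Γ`, and how `A`, `M` and `D` interact. -/

section Subspaces

variable (F : Type*) [Field F]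

theorem x_sq : x F ^ 2 = 1 - y F ^ 4 := by
  have h : Ideal.Quotient.mk (Ideal.span {f F}) (f F) = 0 :=
    Ideal.Quotient.eq_zero_iff_mem.2 (Ideal.subset_span rfl)
  have h' : x F ^ 2 + y F ^ 4 - 1 = 0 := h
  linear_combination h'

theorem D_x : D F (x F) = 2 * y F ^ 3 := by
  rw [x, D_mk]
  simp [polyD, MvPolynomial.pderiv_X, y, map_ofNat (Ideal.Quotient.mk (Ideal.span {f F})) 2]

theorem D_y : D F (y F) = -x F := by
  rw [y, D_mk]
  simp [polyD, MvPolynomial.pderiv_X, x]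

theorem D_y_sq : D F (y F ^ 2) = -2 * (x F * y F) := by
  rw [Derivation.leibniz_pow, D_y]
  simp only [nsmul_eq_mul, smul_eq_mul]
  push_cast
  ring

theorem D_x_mul_y : D F (x F * y F) = 3 * (y F ^ 2) ^ 2 - 1 := by
  rw [Derivation.leibniz, D_x, D_y]
  simp only [smul_eq_mul]
  linear_combination (-1 : Γ F) * x_sq F

/-- With `t = y²`, `s = xy` this is the cubic `s² = t - t³`, the only relation between the
generators that the study of `A` uses. -/
theorem x_mul_y_sq : (x F * y F) ^ 2 = y F ^ 2 - (y F ^ 2) ^ 3 := by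
  linear_combination (y F ^ 2) * x_sq F

theorem y_sq_mem_A : y F ^ 2 ∈ A F := Algebra.subset_adjoin (by simp)

theorem x_mul_y_mem_A : x F * y F ∈ A F := Algebra.subset_adjoin (by simp)

theorem x_mem_M : x F ∈ M F := Submodule.subset_span (by simp)

theorem y_mem_M : y F ∈ M F := Submodule.subset_span (by simp)

variable {F}

theorem mul_mem_M {a m : Γ F} (ha : a ∈ A F) (hm : m ∈ M F) : a * m ∈ M F :=
  (M F).smul_mem (⟨a, ha⟩ : A F) hm

theorem y_cube_mem_M : y F ^ 3 ∈ M F := by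
  have h := mul_mem_M (y_sq_mem_A F) (y_mem_M F)
  rwa [← pow_succ] at h

theorem M_induction {P : Γ F → Prop} (hx : P (x F)) (hy : P (y F)) (h0 : P 0)
    (hadd : ∀ m n, P m → P n → P (m + n)) (hmul : ∀ a ∈ A F, ∀ m ∈ M F, P m → P (a * m))
    {m : Γ F} (hm : m ∈ M F) : P m := by
  refine Submodule.span_induction (R := A F) (p := fun m _ => P m) ?_ h0 (fun m n _ _ => hadd m n)
    (fun a m hm h => hmul a a.2 m hm h) hm
  rintro m (rfl | rfl)
  · exact hx
  · exact hy

theorem mul_mem_A {m n : Γ F} (hm : m ∈ M F) (hn : n ∈ M F) : m * n ∈ A F := by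
  -- Linearity in one factor; used in both factors, it leaves only the products of `x` and `y`.
  have key : ∀ u : Γ F, u * x F ∈ A F → u * y F ∈ A F → ∀ {n}, n ∈ M F → u * n ∈ A F := by
    intro u hx hy n hn
    refine M_induction (P := fun n => u * n ∈ A F) hx hy (by simp) ?_ ?_ hn
    · intro m n hm hn
      rw [mul_add]
      exact add_mem hm hn
    · intro a ha m _ hm
      rw [mul_left_comm]
      exact mul_mem ha hm
  have hxx : x F * x F ∈ A F := by
    rw [← pow_two, x_sq, show y F ^ 4 = (y F ^ 2) ^ 2 by ring]
    exact sub_mem (one_mem _) (pow_mem (y_sq_mem_A F) 2)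
  have hyy : y F * y F ∈ A F := by
    rw [← pow_two]
    exact y_sq_mem_A F
  have hxy := x_mul_y_mem_A F
  have hyx : y F * x F ∈ A F := by rwa [mul_comm]
  refine key m ?_ ?_ hn <;> rw [mul_comm]
  · exact key _ hxx hxy hm
  · exact key _ hyx hyy hm

theorem D_mem_A {a : Γ F} (ha : a ∈ A F) : D F a ∈ A F := by
  refine Algebra.adjoin_induction (p := fun a _ => D F a ∈ A F) ?_ ?_ ?_ ?_ ha
  · rintro a (rfl | rfl | rfl)
    · simp
    · rw [D_y_sq]
      exact mul_mem (neg_mem (ofNat_mem (A F) 2)) (x_mul_y_mem_A F)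
    · rw [D_x_mul_y]
      exact sub_mem (mul_mem (ofNat_mem (A F) 3) (pow_mem (y_sq_mem_A F) 2)) (one_mem _)
  · intro r
    simp
  · intro a b _ _ ha hb
    rw [map_add]
    exact add_mem ha hb
  · intro a b ha' hb' ha hb
    rw [Derivation.leibniz]
    exact add_mem (mul_mem ha' hb) (mul_mem hb' ha)

theorem D_mem_M {m : Γ F} (hm : m ∈ M F) : D F m ∈ M F := by
  refine M_induction (P := fun m => D F m ∈ M F) ?_ ?_ (by simp) ?_ ?_ hm
  · rw [D_x]
    exact mul_mem_M (ofNat_mem (A F) 2) y_cube_mem_M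
  · rw [D_y]
    exact neg_mem (x_mem_M F)
  · intro m n hm hn
    rw [map_add]
    exact add_mem hm hn
  · intro a ha m hm' hm
    rw [Derivation.leibniz, smul_eq_mul, smul_eq_mul, mul_comm m]
    exact add_mem (mul_mem_M ha hm) (mul_mem_M (D_mem_A ha) hm')

theorem one_ne_zero_of_curve : (1 : Γ F) ≠ 0 := by
  intro h
  have h' : Ideal.Quotient.mk (Ideal.span {f F}) 1 = 0 := h
  rw [Ideal.Quotient.eq_zero_iff_mem, Ideal.mem_span_singleton] at h'
  -- The point `(1, 0)` lies on the curve, so evaluation there kills `f` but not 1.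
  have := map_dvd (MvPolynomial.aeval (![1, 0] : Fin 2 → F)) h'
  simp [f] at this

/-- Since `s²` is a polynomial in `t`, the elements `p(t) + s q(t)` are closed under products. -/
theorem exists_eq_aeval_add {a : Γ F} (ha : a ∈ A F) : ∃ p q : Polynomial F,
    a = Polynomial.aeval (y F ^ 2) p + x F * y F * Polynomial.aeval (y F ^ 2) q := by
  refine Algebra.adjoin_induction (p := fun a _ => ∃ p q : Polynomial F,
    a = Polynomial.aeval (y F ^ 2) p + x F * y F * Polynomial.aeval (y F ^ 2) q) ?_ ?_ ?_ ?_ ha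
  · rintro a (rfl | rfl | rfl)
    · exact ⟨1, 0, by simp⟩
    · exact ⟨Polynomial.X, 0, by simp⟩
    · exact ⟨0, 1, by simp⟩
  · exact fun r => ⟨Polynomial.C r, 0, by simp⟩
  · rintro _ _ _ _ ⟨p, q, rfl⟩ ⟨p', q', rfl⟩
    exact ⟨p + p', q + q', by simp only [map_add]; ring⟩
  · rintro _ _ _ _ ⟨p, q, rfl⟩ ⟨p', q', rfl⟩
    refine ⟨p * p' + (Polynomial.X - Polynomial.X ^ 3) * (q * q'), p * q' + p' * q, ?_⟩
    simp only [map_add, map_mul, map_sub, map_pow, Polynomial.aeval_X]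
    linear_combination (Polynomial.aeval (y F ^ 2) q * Polynomial.aeval (y F ^ 2) q') *
      x_mul_y_sq F

open Polynomial in
-- Parity of degrees: `p²` has even degree, while `(X - X³)q²` has odd degree for `q ≠ 0`.
theorem norm_ne_zero {p q : F[X]} (h : p ≠ 0 ∨ q ≠ 0) : p ^ 2 - (X - X ^ 3) * q ^ 2 ≠ 0 := by
  intro h0
  have hc : (X - X ^ 3 : F[X]).natDegree = 3 := by compute_degree!
  have hc0 : (X - X ^ 3 : F[X]) ≠ 0 := by
    intro h
    rw [h] at hc
    simp at hc
  have heq : p ^ 2 = (X - X ^ 3) * q ^ 2 := sub_eq_zero.1 h0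
  by_cases hq : q = 0
  · subst hq
    simp at heq
    simp [heq] at h
  · have := congrArg natDegree heq
    rw [natDegree_mul hc0 (pow_ne_zero 2 hq), natDegree_pow, natDegree_pow, hc] at this
    omega

/-- The extra factor `s` avoids the exponent `n - 1`, so that `n = 0` needs no separate formula. -/
theorem x_mul_y_mul_D_pow (n : ℕ) :
    x F * y F * D F ((x F * y F) ^ n) =
      n * (3 * (y F ^ 2) ^ 2 - 1) * (x F * y F) ^ n := by
  cases n with
  | zero => simp
  | succ n =>
    rw [Derivation.leibniz_pow, D_x_mul_y]
    simp only [nsmul_eq_mul, smul_eq_mul, Nat.add_sub_cancel]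
    ring

end Subspaces

/-! ### Differential simplicity of `A`. -/

section DifferentialSimplicity

variable {F : Type*} [Field F] [CharZero F] {K : Submodule F (Γ F)}

theorem natCast_mul_mem_iff {n : ℕ} (hn : n ≠ 0) {u : Γ F} : (n : Γ F) * u ∈ K ↔ u ∈ K := by
  rw [← nsmul_eq_mul, ← Nat.cast_smul_eq_nsmul F]
  exact Submodule.smul_mem_iff _ (Nat.cast_ne_zero.2 hn)

open Polynomial in
-- Differentiation lowers the degree of `p` at the cost of a factor `s²`, until `p` is a nonzero
-- constant. Nonvanishing is tracked for the polynomial `p`, so independence of the powers of `t` in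
-- `Γ` is not needed.
theorem exists_pow_mem (hA : ∀ a ∈ A F, ∀ u ∈ K, a * u ∈ K) (hD : ∀ u ∈ K, D F u ∈ K) (d : ℕ) :
    ∀ (p : F[X]) (n : ℕ), p ≠ 0 → p.natDegree ≤ d → aeval (y F ^ 2) p * (x F * y F) ^ n ∈ K →
      ∃ N, (x F * y F) ^ N ∈ K := by
  induction d with
  | zero =>
    intro p n hp hd h
    rw [eq_C_of_natDegree_le_zero hd] at h hp
    rw [aeval_C, ← Algebra.smul_def, Submodule.smul_mem_iff _ (by simpa using hp)] at h
    exact ⟨n, h⟩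
  | succ d ih =>
    intro p n hp hd h
    by_cases hd0 : p.natDegree = 0
    · exact ih p n hp (by omega) h
    · refine ih (derivative p) (n + 2) ?_ ?_ ?_
      · exact fun h0 => hd0 (derivative_eq_zero.1 h0)
      · exact Nat.le_of_lt_succ ((natDegree_derivative_lt hd0).trans_le hd)
      -- For `g = p(t)sⁿ`: `n(3t² - 1)g - s D(g) = 2p'(t)sⁿ⁺²`.
      · have h1 := hA _ (x_mul_y_mem_A F) _ (hD _ h)
        have h2 := hA _ (mul_mem (natCast_mem (A F) n) (sub_mem (mul_mem (ofNat_mem (A F) 3)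
          (pow_mem (y_sq_mem_A F) 2)) (one_mem _))) _ h
        refine (natCast_mul_mem_iff two_ne_zero).1 ?_
        convert sub_mem h2 h1 using 1
        rw [Derivation.leibniz, Derivation.map_aeval, D_y_sq]
        simp only [smul_eq_mul]
        push_cast
        linear_combination (aeval (y F ^ 2) p) * x_mul_y_mul_D_pow (F := F) n

theorem one_mem_of_pow_mem (hA : ∀ a ∈ A F, ∀ u ∈ K, a * u ∈ K) (hD : ∀ u ∈ K, D F u ∈ K)
    (n : ℕ) (h : (x F * y F) ^ n ∈ K) : 1 ∈ K := by
  induction n with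
  | zero => simpa using h
  | succ n ih =>
    apply ih
    have h1 := hD _ h
    rw [Derivation.leibniz_pow, D_x_mul_y, nsmul_eq_mul, natCast_mul_mem_iff n.succ_ne_zero] at h1
    simp only [smul_eq_mul, Nat.add_sub_cancel] at h1
    have ht := y_sq_mem_A F
    -- `K` contains `sⁿ(3t² - 1)` and `sⁿ⁺¹`; since `(3t² - 2)(3t² - 1) + 9ts² = 2`, it contains
    -- `2sⁿ`.
    have h2 := hA _ (sub_mem (mul_mem (ofNat_mem (A F) 3) (pow_mem ht 2)) (ofNat_mem (A F) 2)) _ h1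
    have h3 := hA _ (mul_mem (mul_mem (ofNat_mem (A F) 9) ht) (x_mul_y_mem_A F)) _ h
    refine (natCast_mul_mem_iff two_ne_zero).1 ?_
    convert add_mem h2 h3 using 1
    push_cast
    linear_combination (-9 * (x F * y F) ^ n * y F ^ 2) * x_mul_y_sq F

/-- The algebra `A` has no proper nonzero ideals stable under `D`. -/
theorem one_mem_of_D_stable (hA : ∀ a ∈ A F, ∀ u ∈ K, a * u ∈ K) (hD : ∀ u ∈ K, D F u ∈ K)
    {g : Γ F} (hgA : g ∈ A F) (hg : g ∈ K) (hg0 : g ≠ 0) : 1 ∈ K := by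
  obtain ⟨p, q, rfl⟩ := exists_eq_aeval_add hgA
  have hmem : ∀ p : Polynomial F, Polynomial.aeval (y F ^ 2) p ∈ A F := fun p =>
    Algebra.adjoin_le (Set.singleton_subset_iff.2 (y_sq_mem_A F))
      (Polynomial.aeval_mem_adjoin_singleton F _)
  have hpq : p ≠ 0 ∨ q ≠ 0 := by
    by_contra! h
    simp [h.1, h.2] at hg0
  -- Multiplying by the conjugate `p(t) - s q(t)` gives the norm, a polynomial in `t` alone.
  have h := hA _ (sub_mem (hmem p) (mul_mem (x_mul_y_mem_A F) (hmem q))) _ hg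
  obtain ⟨N, hN⟩ := exists_pow_mem hA hD _ _ 0 (norm_ne_zero hpq) le_rfl (by
    convert h using 1
    simp only [map_mul, map_sub, map_pow, Polynomial.aeval_X]
    linear_combination (Polynomial.aeval (y F ^ 2) q) ^ 2 * x_mul_y_sq F)
  exact one_mem_of_pow_mem hA hD N hN

end DifferentialSimplicity

end Curve
-- Moves the ideal problem into the ambient algebra, where coordinates are available. An ideal
-- containing `e` is everything because `u = u * e`.
theorem isSimpleSuperalgebra_induced {F J : Type*} [Field F] [NonUnitalNonAssocRing J]
    [Module F J] [IsScalarTower F J J] [SMulCommClass F J J] {𝒥 : ZMod 2 → Submodule F J}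
    {S : NonUnitalSubalgebra F J} {e : J} (heS : e ∈ S) (he : ∀ u, u * e = u) (he0 : e ≠ 0)
    (h : ∀ I : Submodule F J, I ≤ S.toSubmodule → (∀ u ∈ S, ∀ v ∈ I, u * v ∈ I) →
      (∀ v ∈ I, ∃ v₀ ∈ I, v₀ ∈ 𝒥 0 ∧ ∃ v₁ ∈ I, v₁ ∈ 𝒥 1 ∧ v₀ + v₁ = v) → I = ⊥ ∨ e ∈ I) :
    IsSimpleSuperalgebra F (inducedGrading 𝒥 S) where
  mul_ne_zero := by
    refine ⟨⟨e, heS⟩, ⟨e, heS⟩, fun h0 => he0 ?_⟩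
    rw [← he e]
    exact congrArg Subtype.val h0
  eq_bot_or_eq_top I hI := by
    let ι : S →ₗ[F] J := NonUnitalSubalgebraClass.subtype S
    have hι : Function.Injective ι := Subtype.val_injective
    have key : I.map ι = ⊥ ∨ e ∈ I.map ι := by
      refine h _ ?_ ?_ ?_
      · rintro _ ⟨v, -, rfl⟩
        exact v.2
      · rintro u hu _ ⟨v, hv, rfl⟩
        exact ⟨⟨u, hu⟩ * v, hI.mul_mem_left _ hv, rfl⟩
      · rintro _ ⟨v, hv, rfl⟩
        rw [hI.graded] at hv
        obtain ⟨v₀, ⟨h0, h0'⟩, v₁, ⟨h1, h1'⟩, rfl⟩ := Submodule.mem_sup.1 hv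
        exact ⟨v₀, ⟨v₀, h0, rfl⟩, h0', v₁, ⟨v₁, h1, rfl⟩, h1', rfl⟩
    rcases key with h | ⟨v, hv, rfl⟩
    · exact Or.inl (Submodule.map_injective_of_injective hι (h.trans (Submodule.map_bot ι).symm))
    · refine Or.inr ((Submodule.eq_top_iff').2 fun u => ?_)
      have hu : u * v = u := Subtype.ext (he u)
      exact hu ▸ hI.mul_mem_left u hv

namespace CK

/-! ### The unit and the action of `w₁`, `w₂`, `w₃` on even elements. -/

section Unit

variable {F Γ : Type*} [Field F] [CommRing Γ] [Algebra F Γ] {D : Derivation F Γ Γ}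

variable (D) in
/-- The embedding `a ↦ a` of `Γ` into `CK(Γ, D)`. -/
def ofΓ : Γ →ₗ[F] CK D where
  toFun a := ⟨a, 0, 0, 0⟩
  map_add' a b := by ext <;> simp
  map_smul' c a := by ext <;> simp

theorem ofΓ_apply (a : Γ) : ofΓ D a = ⟨a, 0, 0, 0⟩ := rfl

theorem mul_ofΓ_one (u : CK D) : u * ofΓ D 1 = u := by
  apply ext_coords <;>
    simp [ofΓ_apply, mul_a, mul_w, mul_m, mul_x_zero, mul_x_one, mul_x_two]

theorem ofΓ_one_mul (u : CK D) : ofΓ D 1 * u = u := by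
  apply ext_coords <;>
    simp [ofΓ_apply, mul_a, mul_w, mul_m, mul_x_zero, mul_x_one, mul_x_two]

theorem ofΓ_mul_ofΓ (a b : Γ) : ofΓ D a * ofΓ D b = ofΓ D (a * b) := by
  apply ext_coords <;>
    simp [ofΓ_apply, mul_a, mul_w, mul_m, mul_x_zero, mul_x_one, mul_x_two]

theorem w_zero_mul (a : Γ) (w : Fin 3 → Γ) :
    (⟨0, ![1, 0, 0], 0, 0⟩ * ⟨a, w, 0, 0⟩ : CK D) = ⟨w 0, ![a, 0, 0], 0, 0⟩ := by
  apply ext_coords <;> simp [mul_a, mul_w, mul_m, mul_x_zero, mul_x_one, mul_x_two]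

theorem w_one_mul (a : Γ) (w : Fin 3 → Γ) :
    (⟨0, ![0, 1, 0], 0, 0⟩ * ⟨a, w, 0, 0⟩ : CK D) = ⟨w 1, ![0, a, 0], 0, 0⟩ := by
  apply ext_coords <;> simp [mul_a, mul_w, mul_m, mul_x_zero, mul_x_one, mul_x_two]

theorem w_two_mul (a : Γ) (w : Fin 3 → Γ) :
    (⟨0, ![0, 0, 1], 0, 0⟩ * ⟨a, w, 0, 0⟩ : CK D) = ⟨-w 2, ![0, 0, a], 0, 0⟩ := by
  apply ext_coords <;> simp [mul_a, mul_w, mul_m, mul_x_zero, mul_x_one, mul_x_two]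

theorem even_component_add {u v : CK D} (hu : u ∈ grading D 0) (hv : v ∈ grading D 1) :
    (⟨(u + v).a, (u + v).w, 0, 0⟩ : CK D) = u := by
  rw [mem_grading_zero] at hu
  rw [mem_grading_one] at hv
  ext <;> simp [hu, hv]

theorem odd_component_add {u v : CK D} (hu : u ∈ grading D 0) (hv : v ∈ grading D 1) :
    (⟨0, 0, (u + v).m, (u + v).x⟩ : CK D) = v := by
  rw [mem_grading_zero] at hu
  rw [mem_grading_one] at hv
  ext <;> simp [hu, hv]

end Unit

end CK

namespace Curve

/-! ### Closure of `GCK(A, Δ)` under products, and its graded ideals. -/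

section GradedIdeals

open CK

variable {F : Type*} [Field F]

theorem mem_GCK {u : CK (D F)} : u ∈ GCK F ↔
    u.a ∈ A F ∧ (∀ i, u.w i ∈ A F) ∧ u.m ∈ M F ∧ ∀ i, u.x i ∈ M F := Iff.rfl

theorem even_mem_GCK {b c d e : Γ F} (hb : b ∈ A F) (hc : c ∈ A F) (hd : d ∈ A F)
    (he : e ∈ A F) : (⟨b, ![c, d, e], 0, 0⟩ : CK (D F)) ∈ GCK F := by
  refine mem_GCK.2 ⟨hb, fun i => ?_, zero_mem _, fun _ => zero_mem _⟩
  fin_cases i <;> assumption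

theorem odd_mem_GCK {n : Γ F} (hn : n ∈ M F) : (⟨0, 0, n, 0⟩ : CK (D F)) ∈ GCK F :=
  mem_GCK.2 ⟨zero_mem _, fun _ => zero_mem _, hn, fun _ => zero_mem _⟩

theorem ofΓ_mem_GCK {a : Γ F} (ha : a ∈ A F) : ofΓ (D F) a ∈ GCK F :=
  mem_GCK.2 ⟨ha, fun _ => zero_mem _, zero_mem _, fun _ => zero_mem _⟩

theorem mul_mem_GCK {u v : CK (D F)} (hu : u ∈ GCK F) (hv : v ∈ GCK F) : u * v ∈ GCK F := by
  rw [mem_GCK] at hu hv ⊢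
  obtain ⟨ha, hw, hm, hx⟩ := hu
  obtain ⟨hb, hz, hn, hy⟩ := hv
  refine ⟨?_, fun i => ?_, ?_, ?_⟩
  · rw [mul_a]
    exact add_mem (add_mem (mul_mem ha hb) (sub_mem (add_mem (mul_mem (hw 0) (hz 0))
      (mul_mem (hw 1) (hz 1))) (mul_mem (hw 2) (hz 2))))
      (sub_mem (mul_mem_A (D_mem_M hm) hn) (mul_mem_A hm (D_mem_M hn)))
  · rw [mul_w]
    exact add_mem (add_mem (mul_mem ha (hz i)) (mul_mem hb (hw i)))
      (sub_mem (mul_mem_A (hx i) hn) (mul_mem_A hm (hy i)))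
  · rw [mul_m]
    exact add_mem (mul_mem_M ha hn) (mul_mem_M hb hm)
  · have key : ∀ i j k : Fin 3, ∀ {a n : Γ F} {w y : Fin 3 → Γ F}, a ∈ A F → (∀ i, w i ∈ A F) →
        n ∈ M F → (∀ i, y i ∈ M F) →
        a * y i + D F (w i) * n + (w j * y k - w k * y j) ∈ M F :=
      fun i j k _ _ _ _ ha hw hn hy =>
        add_mem (add_mem (mul_mem_M ha (hy i)) (mul_mem_M (D_mem_A (hw i)) hn))
          (sub_mem (mul_mem_M (hw j) (hy k)) (mul_mem_M (hw k) (hy j)))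
    intro i
    fin_cases i
    · exact add_mem (key 0 2 1 ha hw hn hy) (key 0 2 1 hb hz hm hx)
    · exact add_mem (key 1 0 2 ha hw hn hy) (key 1 0 2 hb hz hm hx)
    · exact add_mem (key 2 0 1 ha hw hn hy) (key 2 0 1 hb hz hm hx)

variable {J : Submodule F (CK (D F))}

/-- Multiplication by `wᵢ` swaps the `Γ` and `wᵢ` coordinates up to sign and kills the other two.
Words in the `wᵢ` thus isolate any coordinate and bring it into `Γ`. -/
theorem ofΓ_mem_of_even (hJ : ∀ u ∈ GCK F, ∀ v ∈ J, u * v ∈ J) {a : Γ F} {w : Fin 3 → Γ F}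
    (h : (⟨a, w, 0, 0⟩ : CK (D F)) ∈ J) : ofΓ (D F) a ∈ J ∧ ∀ i, ofΓ (D F) (w i) ∈ J := by
  have hw0 : (⟨0, ![1, 0, 0], 0, 0⟩ : CK (D F)) ∈ GCK F := even_mem_GCK
    (zero_mem _) (one_mem _) (zero_mem _) (zero_mem _)
  have hw1 : (⟨0, ![0, 1, 0], 0, 0⟩ : CK (D F)) ∈ GCK F := even_mem_GCK
    (zero_mem _) (zero_mem _) (one_mem _) (zero_mem _)
  have hw2 : (⟨0, ![0, 0, 1], 0, 0⟩ : CK (D F)) ∈ GCK F := even_mem_GCK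
    (zero_mem _) (zero_mem _) (zero_mem _) (one_mem _)
  have h1 := hJ _ hw1 _ h
  have ha := hJ _ hw0 _ (hJ _ hw0 _ (hJ _ hw1 _ h1))
  have h0' := hJ _ hw1 _ (hJ _ hw1 _ (hJ _ hw0 _ h))
  have h1' := hJ _ hw0 _ (hJ _ hw0 _ h1)
  have h2' := hJ _ hw0 _ (hJ _ hw0 _ (hJ _ hw2 _ h))
  simp only [w_zero_mul, w_one_mul, w_two_mul] at ha h0' h1' h2'
  have key : ∀ {c d : Γ F} {z : Fin 3 → Γ F}, (⟨c, z, 0, 0⟩ : CK (D F)) ∈ J → c = d → z = 0 →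
      ofΓ (D F) d ∈ J := by
    rintro c _ _ h rfl rfl
    exact h
  refine ⟨key ha (by simp) (by simp), fun i => ?_⟩
  fin_cases i
  · exact key h0' (by simp) (by simp)
  · exact key h1' (by simp) (by simp)
  · exact neg_mem_iff.1 ((map_neg (ofΓ (D F)) (w 2)) ▸ key h2' (by simp) (by simp))

theorem ofΓ_mem_of_odd (hJ : ∀ u ∈ GCK F, ∀ v ∈ J, u * v ∈ J) {m : Γ F} {x : Fin 3 → Γ F}
    (h : (⟨0, 0, m, x⟩ : CK (D F)) ∈ J) {n : Γ F} (hn : n ∈ M F) (i : Fin 3) :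
    ofΓ (D F) (n * x i) ∈ J := by
  have h1 := neg_mem (hJ _ (odd_mem_GCK hn) _ h)
  -- Multiplication by `n̄` turns the `xᵢ` coordinates into `wᵢ` coordinates, up to sign.
  have h2 : (⟨-(D F n * m - n * D F m), fun i => n * x i, 0, 0⟩ : CK (D F)) ∈ J := by
    convert h1 using 1
    apply ext_coords <;> simp [mul_a, mul_w, mul_m, mul_x_zero, mul_x_one, mul_x_two]
  exact (ofΓ_mem_of_even hJ h2).2 i

theorem ofΓ_D_mem_of_odd (hJ : ∀ u ∈ GCK F, ∀ v ∈ J, u * v ∈ J) {m : Γ F} {x : Fin 3 → Γ F}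
    (h : (⟨0, 0, m, x⟩ : CK (D F)) ∈ J) {n b : Γ F} (hn : n ∈ M F) (hb : b ∈ A F) :
    ofΓ (D F) (n * (D F b * m)) ∈ J := by
  have h1 := hJ _ (even_mem_GCK (zero_mem _) hb (zero_mem _) (zero_mem _)) _ h
  -- `w₁b` carries `m` into the `x₁` coordinate, multiplied by `D b`.
  have h2 : (⟨0, 0, 0, ![D F b * m, b * x 2, b * x 1]⟩ : CK (D F)) ∈ J := by
    convert h1 using 1
    apply ext_coords <;> simp [mul_a, mul_w, mul_m, mul_x_zero, mul_x_one, mul_x_two]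
  exact ofΓ_mem_of_odd hJ h2 hn 0

theorem ofΓ_D_mem (hJ : ∀ u ∈ GCK F, ∀ v ∈ J, u * v ∈ J) {a : Γ F} (h : ofΓ (D F) a ∈ J) :
    ofΓ (D F) (D F a) ∈ J := by
  -- `m̄ · (n̄ · a) = (D(m)n - mD(n))a - mnD(a)`, whose first term is already in `J`.
  have key : ∀ {m n : Γ F}, m ∈ M F → n ∈ M F → ofΓ (D F) (m * n * D F a) ∈ J := by
    intro m n hm hn
    have h1 := hJ _ (odd_mem_GCK hm) _ (hJ _ (odd_mem_GCK hn) _ h)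
    have h2 := hJ _ (ofΓ_mem_GCK (sub_mem (mul_mem_A (D_mem_M hm) hn)
      (mul_mem_A hm (D_mem_M hn)))) _ h
    convert sub_mem h2 h1 using 1
    apply ext_coords <;>
      simp [ofΓ_apply, mul_a, mul_w, mul_m, mul_x_zero, mul_x_one, mul_x_two, sub_eq_add_neg]
    ring
  -- The products `x·x` and `y·y³` sum to 1.
  have h1 := add_mem (key (x_mem_M F) (x_mem_M F)) (key (y_mem_M F) y_cube_mem_M)
  rw [← map_add] at h1
  convert h1 using 2
  linear_combination (-D F a) * x_sq F

theorem eq_zero_of_x_mul_of_y_mul {u : Γ F} (hx : x F * u = 0) (hy : y F * u = 0) : u = 0 := by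
  linear_combination x F * hx + y F ^ 3 * hy - u * x_sq F

variable [CharZero F]

theorem eq_bot_or_ofΓ_one_mem (hJG : J ≤ GCK F) (hJ : ∀ u ∈ GCK F, ∀ v ∈ J, u * v ∈ J)
    (hgr : ∀ v ∈ J, (⟨v.a, v.w, 0, 0⟩ : CK (D F)) ∈ J ∧ (⟨0, 0, v.m, v.x⟩ : CK (D F)) ∈ J) :
    J = ⊥ ∨ ofΓ (D F) 1 ∈ J := by
  by_cases hK : ∃ g, ofΓ (D F) g ∈ J ∧ g ≠ 0
  · obtain ⟨g, hg, hg0⟩ := hK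
    refine Or.inr (one_mem_of_D_stable (K := J.comap (ofΓ (D F))) ?_ ?_
      (mem_GCK.1 (hJG hg)).1 hg hg0)
    · intro a ha u hu
      have := hJ _ (ofΓ_mem_GCK ha) _ hu
      rwa [ofΓ_mul_ofΓ] at this
    · exact fun u hu => ofΓ_D_mem hJ hu
  · push Not at hK
    refine Or.inl ((Submodule.eq_bot_iff J).2 fun v hv => ?_)
    obtain ⟨h0, h1⟩ := hgr v hv
    have he := ofΓ_mem_of_even hJ h0
    have hD : ∀ b ∈ A F, D F b * v.m = 0 := fun b hb => eq_zero_of_x_mul_of_y_mul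
      (hK _ (ofΓ_D_mem_of_odd hJ h1 (x_mem_M F) hb)) (hK _ (ofΓ_D_mem_of_odd hJ h1 (y_mem_M F) hb))
    refine CK.ext (hK _ he.1) (funext fun i => hK _ (he.2 i)) ?_
      (funext fun i => eq_zero_of_x_mul_of_y_mul (hK _ (ofΓ_mem_of_odd hJ h1 (x_mem_M F) i))
        (hK _ (ofΓ_mem_of_odd hJ h1 (y_mem_M F) i)))
    -- `m` is killed by `-2s` and `3t² - 1`, hence by 4, twice the constant in the identity above.
    have ht := hD _ (y_sq_mem_A F)
    have hs := hD _ (x_mul_y_mem_A F)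
    rw [D_y_sq] at ht
    rw [D_x_mul_y] at hs
    refine (Submodule.mem_bot F).1 ((natCast_mul_mem_iff four_ne_zero).1 ?_)
    rw [Submodule.mem_bot]
    push_cast
    linear_combination 2 * (3 * (y F ^ 2) ^ 2 - 2) * hs - 9 * y F ^ 2 * (x F * y F) * ht
      - 18 * y F ^ 2 * v.m * x_mul_y_sq F

end GradedIdeals

/-! ### The superalgebra structure on `GCK(A, Δ)`. -/

section Superalgebra

open CK

/-- `GCK(A, Δ)` as a subalgebra of `CK(Γ, D)`. -/
noncomputable def subalgebraGCK (F : Type*) [Field F] : NonUnitalSubalgebra F (CK (D F)) :=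
  { GCK F with mul_mem' := mul_mem_GCK }

variable {F : Type*} [Field F]

theorem isCompl_inducedGrading :
    IsCompl (inducedGrading (grading (D F)) (subalgebraGCK F) 0)
      (inducedGrading (grading (D F)) (subalgebraGCK F) 1) := by
  rw [isCompl_iff, Submodule.disjoint_def, codisjoint_iff, eq_top_iff]
  refine ⟨fun u h0 h1 => ?_, fun u _ => ?_⟩
  · exact Subtype.ext ((Submodule.disjoint_def.1 isCompl_grading.disjoint) _ h0 h1)
  · obtain ⟨ha, hw, hm, hx⟩ := mem_GCK.1 u.2
    refine Submodule.mem_sup.2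
      ⟨⟨⟨u.1.a, u.1.w, 0, 0⟩, mem_GCK.2 ⟨ha, hw, zero_mem _, fun _ => zero_mem _⟩⟩, ⟨rfl, rfl⟩,
        ⟨⟨0, 0, u.1.m, u.1.x⟩, mem_GCK.2 ⟨zero_mem _, fun _ => zero_mem _, hm, hx⟩⟩, ⟨rfl, rfl⟩, ?_⟩
    apply Subtype.ext
    ext <;> simp

theorem isJordanSuperalgebra_GCK [CharZero F] :
    IsJordanSuperalgebra F (inducedGrading (grading (D F)) (subalgebraGCK F)) :=
  CK.isJordanSuperalgebra.induced _ (isInternal_of_isCompl isCompl_inducedGrading)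

theorem hasUnit_GCK : HasUnit (subalgebraGCK F) :=
  ⟨⟨ofΓ (D F) 1, ofΓ_mem_GCK (one_mem _)⟩, fun u =>
    ⟨Subtype.ext (ofΓ_one_mul u.1), Subtype.ext (mul_ofΓ_one u.1)⟩⟩

theorem isSimpleSuperalgebra_GCK [CharZero F] :
    IsSimpleSuperalgebra F (inducedGrading (grading (D F)) (subalgebraGCK F)) := by
  refine isSimpleSuperalgebra_induced (e := ofΓ (D F) 1) (ofΓ_mem_GCK (one_mem _)) mul_ofΓ_one
    (fun h => one_ne_zero_of_curve (F := F) (congrArg CK.a h)) fun J hJS hJ hgr =>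
    eq_bot_or_ofΓ_one_mem hJS hJ fun v hv => ?_
  obtain ⟨v0, h0, h0', v1, h1, h1', rfl⟩ := hgr v hv
  rw [even_component_add h0' h1', odd_component_add h0' h1']
  exact ⟨h0, h1⟩

end Superalgebra

end Curve
/-- The subspace `GCK(A, Δ)` of `CK(Γ, D)` is closed under multiplication, and with the induced
product and grading it is a simple unital Jordan superalgebra. -/
theorem theorem2 (F : Type*) [Field F] [CharZero F] :
    ∃ S : NonUnitalSubalgebra F (CK (Curve.D F)),
      S.toSubmodule = Curve.GCK F ∧
      IsJordanSuperalgebra F (inducedGrading (CK.grading (Curve.D F)) S) ∧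
      HasUnit S ∧
      IsSimpleSuperalgebra F (inducedGrading (CK.grading (Curve.D F)) S) :=
  ⟨Curve.subalgebraGCK F, rfl, Curve.isJordanSuperalgebra_GCK, Curve.hasUnit_GCK,
    Curve.isSimpleSuperalgebra_GCK⟩
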